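/- Let $\mathrm{Mod}$ be the bicategory whose objects are small categories and whose hom-categories are the functor categories $\mathrm{Mod}(A,B)=[B^{\mathrm{op}}\times A,\mathrm{Set}]$ (their objects are called modules from $A$ to $B$), with composition $(n\circ m)(c,a)=\int^{b}m(b,a)\times n(c,b)$ and identities the hom-functors. For a functor $f:A\to B$ let $f_*:A\to B$ be the module $f_*(b,a)=B(b,fa)$. A bicategory $\mathscr{M}$ is said to have tabulations from the terminal when the following two conditions hold. (i) The locally full sub-bicategory $\mathscr{M}_*$ of left adjoint morphisms has a (bicategorical) terminal object $1$ such that, for every object $U$, the essentially unique left adjoint morphism $!_U:U\to 1$ is a terminal object of the category $\mathscr{M}(U,1)$. (ii) Every morphism $u:1\to X$ has a tabulation: a left adjoint morphism $p:U\to X$ together with a 2-cell $\rho:p\Rightarrow u\,!_U$ such that, for every object $K$, the natural transformation $\lambda$ with components $$pw\xrightarrow{\ \rho w\ }u\,!_U\,w\xrightarrow{\ u!\ }u\,!_K\qquad(w\in\mathscr{M}(K,U))$$ exhibits $\mathscr{M}(K,U)$ as a bicategorical comma object in $\mathrm{Cat}$ of the identity functor of $\mathscr{M}(K,X)$ and the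 functor $\mathbf 1\to\mathscr{M}(K,X)$ picking out $u\,!_K$; that is, the induced functor from $\mathscr{M}(K,U)$ to the comma category $\mathscr{M}(K,X)/u\,!_K$, sending $w$ to the object $\lambda_w:pw\to u\,!_K$, is an equivalence of categories. **Proposition.** The bicategory $\mathrm{Mod}$ has tabulations from the terminal. More precisely, the terminal category $\mathbf 1$ has the property in (i), and every module $u:\mathbf 1\to X$, regarded as a presheaf $u:X^{\mathrm{op}}\to\mathrm{Set}$, is tabulated by its category of elements: let $U$ be the category of pairs $(x,e)$ with $e\in u(x)$, whose morphisms $(x,e)\to(x',e')$ are the morphisms $f:x\to x'$ of $X$ with $u(f)(e')=e$, let $P:U\to X$ be the projection $(x,e)\mapsto x$, and let $!_U:=(U\to\mathbf 1)_*$. Then the module $P_*:U\to X$, with the 2-cell $\rho_u:P_*\Rightarrow u\circ{!_U}$ given at $x\in X$ and $(y,e)\in U$ by $X(x,y)\to u(x)\cong(u\circ{!_U})(x,(y,e))$, $f\mapsto u(f)(e)$, is a tabulation of $u$. -/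

import Mathlib

open CategoryTheory Bicategory Opposite

universe u

/-! ### Left adjoint morphisms, biterminal objects and bicategorical comma objects -/

section General

universe w v u₁ u₂ u₃ u₄ v₁ v₂ v₃ v₄

/-- The objects of the bicategory `M_*`: the same as those of `M`. -/
structure LeftAdj (M : Type u₁) where
  /-- The underlying object of `M`. -/
  as : M

namespace LeftAdj

variable {M : Type u₁} [Bicategory.{w, v} M]

/-- The property of being a left adjoint morphism (having a right adjoint). -/
def isLeftAdjoint (a b : M) : ObjectProperty (a ⟶ b) := fun f => IsLeftAdjoint f

/-- The bicategory `M_*`: the locally full sub-bicategory of `M` with all objects and with the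
left adjoint morphisms. -/
instance : Bicategory (LeftAdj M) where
  Hom a b := (isLeftAdjoint a.as b.as).FullSubcategory
  id a := ⟨𝟙 a.as, IsLeftAdjoint.mk (Bicategory.Adjunction.id a.as)⟩
  comp f g := ⟨f.obj ≫ g.obj,
    f.property.nonempty.elim fun r => g.property.nonempty.elim fun s =>
      IsLeftAdjoint.mk (r.adj.comp s.adj)⟩
  homCategory a b := inferInstanceAs (Category (isLeftAdjoint a.as b.as).FullSubcategory)
  whiskerLeft {a b c} f g h (η : InducedCategory.Hom g h) := ObjectProperty.homMk (f.obj ◁ η.hom)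
  whiskerRight {a b c f g} (η : InducedCategory.Hom f g) h :=
    ObjectProperty.homMk (η.hom ▷ h.obj)
  associator f g h := ObjectProperty.isoMk _ (α_ f.obj g.obj h.obj)
  leftUnitor f := ObjectProperty.isoMk _ (λ_ f.obj)
  rightUnitor f := ObjectProperty.isoMk _ (ρ_ f.obj)
  whiskerLeft_id f g := by apply ObjectProperty.hom_ext; exact whiskerLeft_id _ _
  whiskerLeft_comp f _ _ _ η θ := by
    apply ObjectProperty.hom_ext; exact whiskerLeft_comp _ _ _
  id_whiskerLeft η := by apply ObjectProperty.hom_ext; exact id_whiskerLeft _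
  comp_whiskerLeft f g _ _ η := by apply ObjectProperty.hom_ext; exact comp_whiskerLeft _ _ _
  id_whiskerRight f g := by apply ObjectProperty.hom_ext; exact id_whiskerRight _ _
  comp_whiskerRight η θ i := by apply ObjectProperty.hom_ext; exact comp_whiskerRight _ _ _
  whiskerRight_id η := by apply ObjectProperty.hom_ext; exact whiskerRight_id _
  whiskerRight_comp η g h := by apply ObjectProperty.hom_ext; exact whiskerRight_comp _ _ _
  whisker_assoc f _ _ η h := by apply ObjectProperty.hom_ext; exact whisker_assoc _ _ _
  whisker_exchange η θ := by apply ObjectProperty.hom_ext; exact whisker_exchange _ _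
  pentagon f g h i := by apply ObjectProperty.hom_ext; exact pentagon _ _ _ _
  triangle f g := by apply ObjectProperty.hom_ext; exact triangle _ _

end LeftAdj

/-- `T` is a terminal object of the bicategory `B` (in the bicategorical sense): each
hom category `B(U, T)` is equivalent to the terminal category. -/
def IsBiterminal {B : Type u₁} [Bicategory.{w, v} B] (T : B) : Prop :=
  ∀ U : B, Nonempty ((U ⟶ T) ≌ Discrete PUnit.{1})

/-- The functor from `P` to the comma category `F / G` induced by a square
`L : P ⥤ A`, `R : P ⥤ B` with a natural transformation `lam : L ⋙ F ⟶ R ⋙ G`. -/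
def commaComparison {P : Type u₁} [Category.{v₁} P] {A : Type u₂} [Category.{v₂} A]
    {B : Type u₃} [Category.{v₃} B] {C : Type u₄} [Category.{v₄} C]
    {F : A ⥤ C} {G : B ⥤ C} (L : P ⥤ A) (R : P ⥤ B) (lam : L ⋙ F ⟶ R ⋙ G) :
    P ⥤ Comma F G where
  obj w := { left := L.obj w, right := R.obj w, hom := lam.app w }
  map f := { left := L.map f, right := R.map f, w := lam.naturality f }

/-- The square `lam : L ⋙ F ⟶ R ⋙ G` exhibits the category `P` as a bicategorical comma object
of `F` and `G`: the induced functor from `P` to the comma category is an equivalence. -/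
def IsBicategoricalComma {P : Type u₁} [Category.{v₁} P] {A : Type u₂} [Category.{v₂} A]
    {B : Type u₃} [Category.{v₃} B] {C : Type u₄} [Category.{v₄} C]
    {F : A ⥤ C} {G : B ⥤ C} (L : P ⥤ A) (R : P ⥤ B) (lam : L ⋙ F ⟶ R ⋙ G) : Prop :=
  (commaComparison L R lam).IsEquivalence

/-! ### Tabulations from the terminal -/

variable {M : Type u₁} [Bicategory.{w, v} M]

/-- `T` is terminal in the bicategory `M_*` and every left adjoint morphism `U ⟶ T` is a terminal
object of the category `M(U, T)`. -/
structure IsLeftAdjointTerminal (T : M) : Prop where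
  biterminal : IsBiterminal (LeftAdj.mk T)
  isTerminal : ∀ (U : M) (f : U ⟶ T), IsLeftAdjoint f → Nonempty (Limits.IsTerminal f)

/-- The functor `M(K, p) : M(K, U) ⥤ M(K, X)` of composition with `p`. -/
def homPostcomp (K : M) {U X : M} (p : U ⟶ X) : (K ⟶ U) ⥤ (K ⟶ X) where
  obj w := w ≫ p
  map σ := σ ▷ p

/-- The natural transformation with component
`w ≫ p ⟶ w ≫ (bang ≫ u) ≅ (w ≫ bang) ≫ u ⟶ k ≫ u` at `w : K ⟶ U`, where the last 2-cell is
obtained from the unique `w ≫ bang ⟶ k`. -/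
def tabulationCell {T U X : M} {u : T ⟶ X} {bang : U ⟶ T} {p : U ⟶ X} (ρ : p ⟶ bang ≫ u)
    {K : M} {k : K ⟶ T} (hk : Limits.IsTerminal k) :
    homPostcomp K p ⋙ 𝟭 (K ⟶ X) ⟶
      (Functor.const (K ⟶ U)).obj (Discrete.mk PUnit.unit) ⋙ Functor.fromPUnit.{0} (k ≫ u) where
  app w := w ◁ ρ ≫ (α_ w bang u).inv ≫ hk.from (w ≫ bang) ▷ u
  naturality w w' σ := by
    have h : σ ▷ bang ≫ hk.from (w' ≫ bang) = hk.from (w ≫ bang) := hk.hom_ext _ _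
    change σ ▷ p ≫ w' ◁ ρ ≫ (α_ w' bang u).inv ≫ hk.from (w' ≫ bang) ▷ u =
      (w ◁ ρ ≫ (α_ w bang u).inv ≫ hk.from (w ≫ bang) ▷ u) ≫ 𝟙 (k ≫ u)
    rw [← h, comp_whiskerRight, Category.comp_id, ← whisker_exchange_assoc,
      associator_inv_naturality_left_assoc]

/-- The 2-cell `ρ : p ⟶ bang ≫ u` is a tabulation of `u : T ⟶ X`, where `bang : U ⟶ T` is the
left adjoint morphism into the terminal object `T` of `M_*`. For each object `K`, the left adjoint
morphism `k : K ⟶ T` exists and is unique up to isomorphism when `IsLeftAdjointTerminal T`. -/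
structure IsTabulation {T U X : M} (u : T ⟶ X) (bang : U ⟶ T) (p : U ⟶ X)
    (ρ : p ⟶ bang ≫ u) : Prop where
  bang_isLeftAdjoint : IsLeftAdjoint bang
  isLeftAdjoint : IsLeftAdjoint p
  comma : ∀ (K : M) (k : K ⟶ T), IsLeftAdjoint k → ∀ hk : Limits.IsTerminal k,
    IsBicategoricalComma _ _ (tabulationCell ρ hk)

variable (M) in
/-- The bicategory `M` has tabulations from the terminal. -/
def HasTabulationsFromTerminal : Prop :=
  ∃ T : M, IsLeftAdjointTerminal T ∧
    ∀ (X : M) (u : T ⟶ X), ∃ (U : M) (bang : U ⟶ T) (p : U ⟶ X) (ρ : p ⟶ bang ≫ u),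
      IsTabulation u bang p ρ

end General

/-! ### The bicategory of small categories and modules -/

/-- The objects of the bicategory `Mod`: small categories. -/
structure SetMod : Type (u + 1) where
  /-- The underlying type of objects. -/
  carrier : Type u
  [cat : SmallCategory carrier]

namespace SetMod

attribute [instance] SetMod.cat

section Tensor

variable {A B C D : Type u} [SmallCategory A] [SmallCategory B] [SmallCategory C] [SmallCategory D]

theorem map_comp_app (m : Profunctor.{u} A B) {a a' a'' : A} (f : a ⟶ a') (g : a' ⟶ a'')
    (c : Bᵒᵖ) (y : (m.obj a).obj c) :
    (m.map (f ≫ g)).app c y = (m.map g).app c ((m.map f).app c y) := by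
  rw [m.map_comp]; rfl

theorem obj_map_comp (F : Bᵒᵖ ⥤ Type u) {b b' b'' : B} (f : b ⟶ b') (g : b' ⟶ b'')
    (x : F.obj (op b'')) : F.map (f ≫ g).op x = F.map f.op (F.map g.op x) := by
  rw [op_comp, Functor.map_comp_apply]

/-- The relation generating the identifications in the coend `∫^b m(b, a) × n(c, b)`:
`(x · f, y) ∼ (x, f · y)`. -/
inductive TensorRel (m : Profunctor.{u} A B) (n : Profunctor.{u} B C) (a : A) (c : Cᵒᵖ) :
    (Σ b : B, (m.obj a).obj (op b) × (n.obj b).obj c) →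
    (Σ b : B, (m.obj a).obj (op b) × (n.obj b).obj c) → Prop
  | mk {b b' : B} (f : b ⟶ b') (x : (m.obj a).obj (op b')) (y : (n.obj b).obj c) :
      TensorRel m n a c ⟨b, (m.obj a).map f.op x, y⟩ ⟨b', x, (n.map f).app c y⟩

/-- The coend `∫^b m(b, a) × n(c, b)`. -/
def TensorObj (m : Profunctor.{u} A B) (n : Profunctor.{u} B C) (a : A) (c : Cᵒᵖ) : Type u :=
  Quot (TensorRel m n a c)

/-- The class of `(x, y)` in the coend. -/
def tmk {m : Profunctor.{u} A B} {n : Profunctor.{u} B C} {a : A} {c : Cᵒᵖ} {b : B}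
    (x : (m.obj a).obj (op b)) (y : (n.obj b).obj c) : TensorObj m n a c :=
  Quot.mk _ ⟨b, x, y⟩

theorem tmk_sound {m : Profunctor.{u} A B} {n : Profunctor.{u} B C} {a : A} {c : Cᵒᵖ} {b b' : B}
    (f : b ⟶ b') (x : (m.obj a).obj (op b')) (y : (n.obj b).obj c) :
    (tmk ((m.obj a).map f.op x) y : TensorObj m n a c) = tmk x ((n.map f).app c y) :=
  Quot.sound (TensorRel.mk f x y)

theorem tensor_ind {m : Profunctor.{u} A B} {n : Profunctor.{u} B C} {a : A} {c : Cᵒᵖ}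
    {P : TensorObj m n a c → Prop}
    (h : ∀ (b : B) (x : (m.obj a).obj (op b)) (y : (n.obj b).obj c), P (tmk x y)) (t) : P t :=
  Quot.ind (fun ⟨b, x, y⟩ => h b x y) t

/-- The universal property of the coend, for functions into a type. -/
def tensorDesc {m : Profunctor.{u} A B} {n : Profunctor.{u} B C} {a : A} {c : Cᵒᵖ} {Z : Type u}
    (φ : ∀ b : B, (m.obj a).obj (op b) → (n.obj b).obj c → Z)
    (h : ∀ {b b' : B} (f : b ⟶ b') (x : (m.obj a).obj (op b')) (y : (n.obj b).obj c),
      φ b ((m.obj a).map f.op x) y = φ b' x ((n.map f).app c y)) :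
    TensorObj m n a c → Z :=
  Quot.lift (fun t => φ t.1 t.2.1 t.2.2) (by rintro _ _ ⟨f, x, y⟩; exact h f x y)

/-- The functions between coends induced by a family compatible with the middle actions. -/
def tensorMapFun {m m' : Profunctor.{u} A B} {n n' : Profunctor.{u} B C} {a a' : A} {c c' : Cᵒᵖ}
    (φ : (m.obj a) ⟶ (m'.obj a')) (ψ : n ⋙ (evaluation _ _).obj c ⟶ n' ⋙ (evaluation _ _).obj c') :
    TensorObj m n a c → TensorObj m' n' a' c' :=
  tensorDesc (fun b x y => tmk (φ.app (op b) x) (ψ.app b y)) (by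
    intro b b' f x y
    have h1 : φ.app (op b) ((m.obj a).map f.op x) = (m'.obj a').map f.op (φ.app (op b') x) :=
      NatTrans.naturality_apply φ f.op x
    have h2 : ψ.app b' ((n.map f).app c y) = (n'.map f).app c' (ψ.app b y) :=
      NatTrans.naturality_apply ψ f y
    rw [h1, h2]
    exact tmk_sound f _ _)

/-- Composition of modules: `(m ; n)(c, a) = ∫^b m(b, a) × n(c, b)`. -/
def tensor (m : Profunctor.{u} A B) (n : Profunctor.{u} B C) : Profunctor.{u} A C where
  obj a :=
    { obj := fun c => TensorObj m n a c
      map := fun {c c'} g => ↾(tensorMapFun (𝟙 (m.obj a))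
        (Functor.whiskerLeft n ((evaluation _ _).map g)))
      map_id := fun c => by
        ext t; induction t using tensor_ind with | h b x y => ?_
        change tmk x ((n.obj b).map (𝟙 c) y) = tmk x y
        rw [Functor.map_id_apply]
      map_comp := fun {c c' c''} g h => by
        ext t; induction t using tensor_ind with | h b x y => ?_
        change tmk x ((n.obj b).map (g ≫ h) y) = tmk x ((n.obj b).map h ((n.obj b).map g y))
        rw [Functor.map_comp_apply] }
  map {a a'} f :=
    { app := fun c => ↾(tensorMapFun (m.map f) (𝟙 _))
      naturality := fun c c' g => by
        ext t; induction t using tensor_ind with | h b x y => rfl }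
  map_id a := by
    ext c t; induction t using tensor_ind with | h b x y => ?_
    change tmk ((m.map (𝟙 a)).app (op b) x) y = tmk x y
    rw [m.map_id]; rfl
  map_comp {a a' a''} f g := by
    ext c t; induction t using tensor_ind with | h b x y => ?_
    change tmk ((m.map (f ≫ g)).app (op b) x) y = tmk ((m.map g).app _ ((m.map f).app _ x)) y
    rw [m.map_comp]; rfl

/-- Horizontal composition of module morphisms. -/
def tensorMap {m m' : Profunctor.{u} A B} {n n' : Profunctor.{u} B C} (φ : m ⟶ m') (ψ : n ⟶ n') :
    tensor m n ⟶ tensor m' n' where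
  app a :=
    { app := fun c => ↾(tensorMapFun (φ.app a) (Functor.whiskerRight ψ ((evaluation _ _).obj c)))
      naturality := fun c c' g => by
        ext t; induction t using tensor_ind with | h b x y => ?_
        change tmk ((φ.app a).app (op b) x) ((ψ.app b).app c' ((n.obj b).map g y)) =
          tmk ((φ.app a).app (op b) x) ((n'.obj b).map g ((ψ.app b).app c y))
        rw [NatTrans.naturality_apply (ψ.app b) g y] }
  naturality a a' f := by
    ext c t; induction t using tensor_ind with | h b x y => ?_
    change tmk ((φ.app a').app (op b) ((m.map f).app (op b) x)) ((ψ.app b).app c y) =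
      tmk ((m'.map f).app (op b) ((φ.app a).app (op b) x)) ((ψ.app b).app c y)
    have h := congrArg (fun α => α.app (op b) x) (φ.naturality f)
    exact congrArg (fun z => tmk z ((ψ.app b).app c y)) h

theorem tensor_hom_ext {m : Profunctor.{u} A B} {n : Profunctor.{u} B C} {q : Profunctor.{u} A C}
    {α β : tensor m n ⟶ q}
    (h : ∀ (a : A) (c : Cᵒᵖ) (b : B) (x : (m.obj a).obj (op b)) (y : (n.obj b).obj c),
      (α.app a).app c (tmk x y) = (β.app a).app c (tmk x y)) : α = β := by
  ext a c t; induction t using tensor_ind with | h b x y => exact h a c b x y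

/-- `(1 ; m) ≅ m`, given by the right action: `(f, y) ↦ f · y`. -/
def leftUnit (m : Profunctor.{u} A B) : tensor Profunctor.id m ≅ m :=
  NatIso.ofComponents (fun a => NatIso.ofComponents (fun c =>
    { hom := ↾(tensorDesc (fun (a' : A) (f : a' ⟶ a) y => (m.map f).app c y) (by
        intro b b' f x y
        exact map_comp_app m f x c y))
      inv := ↾(fun y => tmk (𝟙 a : a ⟶ a) y)
      hom_inv_id := by
        ext t; induction t using tensor_ind with | h b x y => ?_
        change tmk (𝟙 a : a ⟶ a) ((m.map x).app c y) = tmk x y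
        refine (tmk_sound (m := Profunctor.id) (n := m) x (𝟙 a) y).symm.trans ?_
        exact congrArg (fun z => tmk z y) (Category.comp_id x)
      inv_hom_id := by
        ext y
        change (m.map (𝟙 a)).app c y = y
        rw [m.map_id]; rfl })
    (by
      intro c c' g
      ext t; induction t using tensor_ind with | h b x y => ?_
      exact NatTrans.naturality_apply (m.map x) g y))
    (by
      intro a a' f
      ext c t; induction t using tensor_ind with | h b x y => ?_
      exact map_comp_app m x f c y)

/-- `(m ; 1) ≅ m`, given by the left action: `(x, f) ↦ x · f`. -/
def rightUnit (m : Profunctor.{u} A B) : tensor m Profunctor.id ≅ m :=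
  NatIso.ofComponents (fun a => NatIso.ofComponents (fun c =>
    { hom := ↾(tensorDesc (fun (b : B) x (f : c.unop ⟶ b) => (m.obj a).map f.op x) (by
        intro b b' f x y
        exact (obj_map_comp (m.obj a) y f x).symm))
      inv := ↾(fun x => tmk (n := Profunctor.id) (b := c.unop) x (𝟙 c.unop : c.unop ⟶ c.unop))
      hom_inv_id := by
        ext t; induction t using tensor_ind with | h b x y => ?_
        refine (tmk_sound (m := m) (n := Profunctor.id) (c := c) y x (𝟙 c.unop)).trans ?_
        exact congrArg (fun z => tmk x z) (Category.id_comp y)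
      inv_hom_id := by
        ext y
        exact Functor.map_id_apply (m.obj a) _ y })
    (by
      intro c c' g
      ext t; induction t using tensor_ind with | h b x y => ?_
      exact obj_map_comp (m.obj a) g.unop y x))
    (by
      intro a a' f
      ext c t; induction t using tensor_ind with | h b x y => ?_
      exact (NatTrans.naturality_apply (m.map f) (Quiver.Hom.op y) x).symm)

/-- `((m ; n) ; r) ≅ (m ; (n ; r))`, given by `((x, y), z) ↦ (x, (y, z))`. -/
def assoc (m : Profunctor.{u} A B) (n : Profunctor.{u} B C) (r : Profunctor.{u} C D) :
    tensor (tensor m n) r ≅ tensor m (tensor n r) :=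
  NatIso.ofComponents (fun a => NatIso.ofComponents (fun d =>
    { hom := ↾(tensorDesc (fun c t z => tensorDesc
          (fun b x y => (tmk x (tmk y z : TensorObj n r b d) : TensorObj m (tensor n r) a d))
          (fun f x y => tmk_sound (n := tensor n r) f x (tmk y z : TensorObj n r _ d)) t) (by
        intro c c' g t z
        induction t using tensor_ind with | h b x y => ?_
        exact congrArg (fun s => (tmk x s : TensorObj m (tensor n r) a d)) (tmk_sound g y z)))
      inv := ↾(tensorDesc (fun b x t => tensorDesc
          (fun c y z => (tmk (tmk x y : TensorObj m n a (op c)) z : TensorObj (tensor m n) r a d))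
          (fun g y z => tmk_sound (m := tensor m n) g (tmk x y : TensorObj m n a _) z) t) (by
        intro b b' f x t
        induction t using tensor_ind with | h c y z => ?_
        exact congrArg (fun s => (tmk s z : TensorObj (tensor m n) r a d)) (tmk_sound f x y)))
      hom_inv_id := by
        ext t; induction t using tensor_ind with | h c t z => ?_
        induction t using tensor_ind with | h b x y => rfl
      inv_hom_id := by
        ext t; induction t using tensor_ind with | h b x t => ?_
        induction t using tensor_ind with | h c y z => rfl })
    (by
      intro d d' g
      ext t; induction t using tensor_ind with | h c t z => ?_
      induction t using tensor_ind with | h b x y => rfl))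
    (by
      intro a a' f
      ext d t; induction t using tensor_ind with | h c t z => ?_
      induction t using tensor_ind with | h b x y => rfl)

end Tensor

/-- The bicategory `Mod` of small categories, modules and module morphisms. -/
instance : Bicategory SetMod.{u} where
  Hom A B := Profunctor.{u} A.carrier B.carrier
  id _ := Profunctor.id
  comp m n := tensor m n
  homCategory A B := inferInstanceAs (Category (Profunctor.{u} A.carrier B.carrier))
  whiskerLeft m _ _ η := tensorMap (𝟙 m) η
  whiskerRight {_ _ _ m m'} η n := tensorMap (m := m) (m' := m') η (𝟙 n)
  associator m n r := assoc m n r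
  leftUnitor m := leftUnit m
  rightUnitor m := rightUnit m
  whiskerLeft_id m n := by
    refine tensor_hom_ext fun a c b x y => ?_
    rfl
  whiskerLeft_comp m _ _ _ η θ := by
    refine tensor_hom_ext fun a c b x y => ?_
    rfl
  id_whiskerLeft η := by
    rw [← Category.assoc, Iso.eq_comp_inv]
    refine tensor_hom_ext fun a c b x y => ?_
    exact (congrArg (fun α => α.app c y) (η.naturality x)).symm
  comp_whiskerLeft m n _ _ η := by
    rw [← Category.assoc, Iso.eq_comp_inv]
    refine tensor_hom_ext fun a c b t z => ?_
    induction t using tensor_ind with | h b x y => rfl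
  id_whiskerRight m n := by
    refine tensor_hom_ext fun a c b x y => ?_
    rfl
  comp_whiskerRight η θ n := by
    refine tensor_hom_ext fun a c b x y => ?_
    rfl
  whiskerRight_id η := by
    rw [← Category.assoc, Iso.eq_comp_inv]
    refine tensor_hom_ext fun a c b x y => ?_
    exact (NatTrans.naturality_apply (η.app a) (Quiver.Hom.op y) x).symm
  whiskerRight_comp η n r := by
    rw [Iso.eq_inv_comp]
    refine tensor_hom_ext fun a c b t z => ?_
    induction t using tensor_ind with | h b x y => rfl
  whisker_assoc m _ _ η r := by
    rw [← Category.assoc, Iso.eq_comp_inv]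
    refine tensor_hom_ext fun a c b t z => ?_
    induction t using tensor_ind with | h b x y => rfl
  whisker_exchange η θ := by
    refine tensor_hom_ext fun a c b x y => ?_
    rfl
  pentagon m n r s := by
    refine tensor_hom_ext fun a c b t z => ?_
    induction t using tensor_ind with | h b t y => ?_
    induction t using tensor_ind with | h b x y => rfl
  triangle m n := by
    refine tensor_hom_ext fun a c b t z => ?_
    induction t using tensor_ind with | h b x y => ?_
    exact (tmk_sound y x z).symm

/-- The module `f_* : A ⟶ B` induced by a functor `f : A ⥤ B`, with `f_*(b, a) = B(b, f a)`. -/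
def lowerStar {A B : SetMod.{u}} (f : A.carrier ⥤ B.carrier) : A ⟶ B := f.toProfunctor

/-- The terminal category `1`, as an object of `Mod`. -/
def one : SetMod.{u} := SetMod.mk (Discrete PUnit.{u + 1})

/-- The module `!_* : A ⟶ 1` induced by the unique functor `A ⥤ 1`. -/
def bang (A : SetMod.{u}) : A ⟶ one := lowerStar (A := A) (B := one) (Functor.star A.carrier)

variable {X : SetMod.{u}}

/-- A module `1 ⟶ X` as a presheaf on `X`. -/
def presheaf (m : one ⟶ X) : X.carrierᵒᵖ ⥤ Type u :=
  Functor.obj (C := Discrete PUnit.{u + 1}) (D := X.carrierᵒᵖ ⥤ Type u) m ⟨PUnit.unit⟩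

/-- The category of elements of the presheaf `m : 1 ⟶ X`: the objects are pairs `(x, e)` with
`e ∈ m(x)`, and a morphism `(x, e) ⟶ (x', e')` is a morphism `f : x ⟶ x'` of `X` such that
`m(f)(e') = e`. -/
def El (m : one ⟶ X) : SetMod.{u} := SetMod.mk (presheaf m).Elementsᵒᵖ

/-- The projection functor `(x, e) ↦ x`. -/
def elProj (m : one ⟶ X) : (El m).carrier ⥤ X.carrier :=
  (CategoryOfElements.π (presheaf m)).leftOp

/-- The element of `(!_* ; m)(x, a) = ∫^{∗} 1 × m(x, ∗)` given by an element of `m(x)`. -/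
def bangMk (m : one ⟶ X) (A : SetMod.{u}) (a : A.carrier) (x : X.carrierᵒᵖ)
    (z : (presheaf m).obj x) :
    TensorObj (Functor.toProfunctor (D := Discrete PUnit.{u + 1}) (Functor.star A.carrier))
      (C := X.carrier) m a x :=
  tmk (b := (⟨PUnit.unit⟩ : Discrete PUnit.{u + 1})) (𝟙 (⟨PUnit.unit⟩ : Discrete PUnit.{u + 1})) z

/-- The canonical 2-cell `p_* ⟶ !_* ; m` for the category of elements `p : El m ⥤ X`, sending
`f ∈ X(x, y)`, at the element `(y, e)`, to `m(f)(e) ∈ m(x)`. -/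
def elCell (m : one ⟶ X) : lowerStar (elProj m) ⟶ bang (El m) ≫ m where
  app (e : (presheaf m).Elementsᵒᵖ) :=
    { app := fun x => ↾(fun f : x.unop ⟶ e.unop.1.unop =>
        bangMk m (El m) e x ((presheaf m).map f.op e.unop.2))
      naturality := fun x x' g => by
        ext f
        exact congrArg (bangMk m (El m) e x') (obj_map_comp (presheaf m) g.unop f e.unop.2) }
  naturality (e e' : (presheaf m).Elementsᵒᵖ) h := by
    ext x f
    refine congrArg (bangMk m (El m) e' x)
      ((obj_map_comp (presheaf m) f h.unop.1.unop e'.unop.2).trans ?_)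
    exact congrArg ((presheaf m).map (Quiver.Hom.op f)) h.unop.2

end SetMod

/-! Every functor `f` gives an adjunction `f_* ⊣ f^*`, so `bang` and the projection from the
category of elements induce left adjoint modules. Conversely, a left adjoint module into `one` has
singleton values: the triangle identity recovers every element from the unit at an identity, because
the counit takes values among the endomorphisms of the point. Such a module is terminal among all
modules into `one`, which gives condition (i). For condition (ii), let `P` be the presheaf given by
`m`. Its projection is a discrete fibration: each `f : x ⟶ y` lifts uniquely to a morphism `(x,
P(f)(e)) ⟶ (y, e)`. The coend defining `w ; p_*` therefore splits as `(w ; p_*)(x, a) ≅ Σ e ∈ P(x),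
w((x, e), a)` (`toSigma`, `incl`). Since `k` has singleton values, `k ; m` is the presheaf `P`,
constant in `a`, and the tabulation 2-cell becomes the projection of the sum to its index `e`
(`bangEval_tabulationCell`). The comparison functor is then the familiar equivalence between
families indexed by the elements of `P` and objects over `P`, with quasi-inverse given by fibers
(`exists_tensorMap_eq`, `isIso_fiberModuleHom`). -/

namespace SetMod

/-! ### The adjunction between the modules induced by a functor. -/

section Adjunction

variable {A B : SetMod.{u}}

/-- The module `f^* : B ⟶ A` induced by a functor `f : A ⥤ B`, with `f^*(a, b) = B(f a, b)`. -/
def upperStar (f : A.carrier ⥤ B.carrier) : B ⟶ A := f.toProfunctorRev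

theorem hom_app_ext {m n : A ⟶ B} {α β : m ⟶ n}
    (h : ∀ (a : A.carrier) (b : B.carrierᵒᵖ) (x : (Functor.obj m a).obj b),
      (NatTrans.app α a).app b x = (NatTrans.app β a).app b x) : α = β :=
  NatTrans.ext (funext fun a => NatTrans.ext (funext fun b => by ext x; exact h a b x))

/-- The unit `1 ⟶ f_* ; f^*`, sending `g` to the class of `(1, f g)`. -/
def starUnit (f : A.carrier ⥤ B.carrier) : 𝟙 A ⟶ lowerStar f ≫ upperStar f where
  app (a : A.carrier) :=
    { app := fun c => ↾(fun g : c.unop ⟶ a =>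
        (tmk (m := f.toProfunctor) (n := f.toProfunctorRev) (𝟙 (f.obj a)) (f.map g) :
          TensorObj f.toProfunctor f.toProfunctorRev a c))
      naturality := fun c c' g => by
        ext x
        exact congrArg (fun z => (tmk (m := f.toProfunctor) (n := f.toProfunctorRev)
          (𝟙 (f.obj a)) z : TensorObj f.toProfunctor f.toProfunctorRev a c'))
          (f.map_comp g.unop x) }
  naturality (a a' : A.carrier) g := by
    ext c (x : c.unop ⟶ a)
    change (tmk (m := f.toProfunctor) (n := f.toProfunctorRev) (𝟙 (f.obj a')) (f.map (x ≫ g)) :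
        TensorObj f.toProfunctor f.toProfunctorRev a' c) =
      tmk (m := f.toProfunctor) (n := f.toProfunctorRev) (𝟙 (f.obj a) ≫ f.map g) (f.map x)
    have h := tmk_sound (m := f.toProfunctor) (n := f.toProfunctorRev) (a := a') (c := c)
      (f.map g) (𝟙 (f.obj a')) (f.map x)
    rw [f.map_comp]
    refine h.symm.trans ?_
    refine congrArg (fun z => (tmk (m := f.toProfunctor) (n := f.toProfunctorRev)
          z (f.map x) : TensorObj f.toProfunctor f.toProfunctorRev a' c)) ?_
    exact (Category.comp_id (f.map g)).trans (Category.id_comp (f.map g)).symm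

/-- The counit `f^* ; f_* ⟶ 1`, given by composition. -/
def starCounit (f : A.carrier ⥤ B.carrier) : upperStar f ≫ lowerStar f ⟶ 𝟙 B where
  app (b : B.carrier) :=
    { app := fun c => ↾(tensorDesc (m := f.toProfunctorRev) (n := f.toProfunctor)
        (fun (a : A.carrier) (x : f.obj a ⟶ b) (y : c.unop ⟶ f.obj a) => y ≫ x)
        (fun g x y => (Category.assoc y (f.map g) x).symm))
      naturality := fun c c' g => by
        ext t; induction t using tensor_ind with | h a x y => ?_
        exact Category.assoc g.unop y x }
  naturality (b b' : B.carrier) g := by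
    ext c t; induction t using tensor_ind with | h a x y => ?_
    exact (Category.assoc y x g).symm

/-- The adjunction between `f_*` and `f^*`. -/
def starAdjunction (f : A.carrier ⥤ B.carrier) : lowerStar f ⊣ upperStar f where
  unit := starUnit f
  counit := starCounit f
  left_triangle := by
    -- The zigzag hides its associator in a coherence isomorphism; the explicit form can be
    -- evaluated on classes.
    have e : leftZigzag (starUnit f) (starCounit f) =
        starUnit f ▷ lowerStar f ≫ (α_ _ _ _).hom ≫ lowerStar f ◁ starCounit f := by
      bicategory
    rw [e]
    refine tensor_hom_ext fun a c b x y => ?_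
    -- The zigzag sends `(x, y)` to `(1, y ≫ f.map x)`, the unitors to `(y ≫ f.map x, 1)`; the coend
    -- relation slides `y ≫ f.map x` across.
    have h := tmk_sound (m := f.toProfunctor) (n := Profunctor.id) (a := a) (c := c)
      (y ≫ f.map x) (𝟙 (f.obj a)) (𝟙 c.unop)
    refine (congrArg (fun z => (tmk (m := f.toProfunctor) (n := Profunctor.id)
          (𝟙 (f.obj a)) z : TensorObj f.toProfunctor Profunctor.id a c)) ?_).trans (h.symm.trans
      (congrArg (fun z => (tmk (m := f.toProfunctor) (n := Profunctor.id)
          z (𝟙 c.unop) : TensorObj f.toProfunctor Profunctor.id a c)) ?_))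
    · exact (Category.id_comp (y ≫ f.map x)).symm
    · exact Category.comp_id (y ≫ f.map x)
  right_triangle := by
    have e : rightZigzag (starUnit f) (starCounit f) =
        upperStar f ◁ starUnit f ≫ (α_ _ _ _).inv ≫ starCounit f ▷ upperStar f := by
      bicategory
    rw [e]
    refine tensor_hom_ext fun b c a x y => ?_
    have h := tmk_sound (m := Profunctor.id) (n := f.toProfunctorRev) (a := b) (c := c)
      x (𝟙 b) (f.map y)
    refine Eq.trans ?_ h
    refine congrArg (fun z => (tmk (m := Profunctor.id) (n := f.toProfunctorRev)
          z (f.map y) : TensorObj Profunctor.id f.toProfunctorRev b c)) ?_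
    exact (Category.id_comp x).trans (Category.comp_id x).symm

theorem lowerStar_isLeftAdjoint (f : A.carrier ⥤ B.carrier) : IsLeftAdjoint (lowerStar f) :=
  IsLeftAdjoint.mk (starAdjunction f)

end Adjunction

/-! ### Left adjoint modules into the terminal category. -/

section Terminal

variable {A : SetMod.{u}}

/-- The value at `a` of a module `A ⟶ 1`. -/
abbrev fiber (k : A ⟶ one) (a : A.carrier) : Type u :=
  (Functor.obj (C := A.carrier) (D := (Discrete PUnit.{u + 1})ᵒᵖ ⥤ Type u) k a).obj
    (op ⟨PUnit.unit⟩)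

/-- A module `A ⟶ 1` whose values are singletons is terminal. -/
noncomputable def isTerminalOfUnique (k : A ⟶ one) (h : ∀ a, Nonempty (Unique (fiber k a))) :
    Limits.IsTerminal k :=
  have hs (a : A.carrier) (x y : fiber k a) : x = y :=
    (h a).elim fun i => (i.uniq x).trans (i.uniq y).symm
  Limits.IsTerminal.ofUniqueHom
    (fun n =>
      { app := fun (a : A.carrier) =>
          { app := fun _ => ↾(fun _ => (Classical.choice (h a)).default)
            naturality := fun _ _ _ => by ext; exact hs a _ _ }
        naturality := fun a a' g => by ext; exact hs a' _ _ })
    (fun n α => hom_app_ext fun a b x => hs a _ _)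

/-- Left adjoint modules `A ⟶ 1` have singleton values. -/
theorem unique_fiber_of_isLeftAdjoint (k : A ⟶ one) (hk : IsLeftAdjoint k) (a : A.carrier) :
    Nonempty (Unique (fiber k a)) := by
  obtain ⟨⟨r, adj⟩⟩ := hk
  have e : adj.unit ▷ k ≫ (α_ _ _ _).hom ≫ k ◁ adj.counit = (λ_ _).hom ≫ (ρ_ _).inv := by
    rw [← adj.left_triangle]; bicategory
  have e' : adj.unit ▷ k ≫ (α_ _ _ _).hom ≫ k ◁ adj.counit ≫ (ρ_ _).hom = (λ_ _).hom := by
    rw [← Category.assoc, ← Category.assoc, Category.assoc (adj.unit ▷ k), e, Category.assoc,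
      Iso.inv_hom_id, Category.comp_id]
  -- The unit at `𝟙 a` supplies the candidate `x`. Evaluated at `(𝟙 a, z)`, the triangle identity
  -- says that `z` is `x` acted on by the counit of `(y, z)`; this is an endomorphism of the point,
  -- hence trivial.
  obtain ⟨⟨⟨⟨⟩⟩, x, y⟩, hxy⟩ := Quot.exists_rep ((NatTrans.app adj.unit a).app (op a) (𝟙 a : a ⟶ a))
  refine ⟨{ default := x, uniq := fun z => ?_ }⟩
  have h : (NatTrans.app ((α_ _ _ _).hom ≫ k ◁ adj.counit ≫ (ρ_ _).hom : (k ≫ r) ≫ k ⟶ k) a).app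
      (op ⟨PUnit.unit⟩) (tmk (m := tensor k r) (n := k)
        ((NatTrans.app adj.unit a).app (op a) (𝟙 a : a ⟶ a)) z) =
      (CategoryTheory.Functor.map k (𝟙 a)).app (op ⟨PUnit.unit⟩) z :=
    congrArg (fun α : 𝟙 A ≫ k ⟶ k => (NatTrans.app α a).app (op ⟨PUnit.unit⟩)
      (tmk (m := Profunctor.id) (n := k) (𝟙 a : a ⟶ a) z)) e'
  rw [← hxy, CategoryTheory.Functor.map_id] at h
  refine h.symm.trans ?_
  set f : (⟨PUnit.unit⟩ : Discrete PUnit.{u + 1}) ⟶ ⟨PUnit.unit⟩ :=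
    (NatTrans.app adj.counit ⟨PUnit.unit⟩).app (op ⟨PUnit.unit⟩) (tmk y z) with hf
  change (Functor.obj k a).map f.op x = x
  rw [Subsingleton.elim f (𝟙 _)]
  exact Functor.map_id_apply (Functor.obj k a) _ x

/-- Left adjoints into `one` are terminal among all modules, so any two are uniquely isomorphic;
`bang` shows that one exists. The full subcategory of left adjoints is thus equivalent to a point.
-/
theorem isLeftAdjointTerminal_one : IsLeftAdjointTerminal one.{u} where
  biterminal U := by
    have ht (f : U ⟶ LeftAdj.mk one) : Limits.IsTerminal f.obj :=
      isTerminalOfUnique f.obj (unique_fiber_of_isLeftAdjoint f.obj f.property)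
    let b : U ⟶ LeftAdj.mk one := ⟨bang U.as, lowerStar_isLeftAdjoint _⟩
    exact ⟨
      { functor := Functor.star _
        inverse := Functor.fromPUnit b
        unitIso := NatIso.ofComponents
          (fun f => ObjectProperty.isoMk _ ((ht f).uniqueUpToIso (ht b)))
          (fun {f g} α => ObjectProperty.hom_ext _ ((ht b).hom_ext _ _))
        counitIso := Functor.punitExt _ _
        functor_unitIso_comp := fun _ => Subsingleton.elim _ _ }⟩
  isTerminal U f hf := ⟨isTerminalOfUnique f (unique_fiber_of_isLeftAdjoint f hf)⟩

end Terminal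
-- Composition with the projection of a category of elements.
section Elements

variable {K X : Type u} [SmallCategory K] [SmallCategory X]

/-- The module `p_*` induced by the projection `p` of the category of elements of `P`. -/
abbrev elStar (P : Xᵒᵖ ⥤ Type u) : Profunctor.{u} P.Elementsᵒᵖ X :=
  (CategoryOfElements.π P).leftOp.toProfunctor

variable {P : Xᵒᵖ ⥤ Type u} (w : Profunctor.{u} K P.Elementsᵒᵖ)

/-- The class of `(z, 1)` in the coend `∫^{(y, e)} w((y, e), a) × X(x, y)`. -/
def incl (a : K) (d : P.Elements) (z : (w.obj a).obj (op (op d))) : TensorObj w (elStar P) a d.1 :=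
  tmk z (𝟙 d.1.unop : d.1.unop ⟶ d.1.unop)

/-- Every class is a restriction of one of the form `incl`, so transformations natural in `c` are
determined by their values on `incl`. -/
theorem tmk_eq_map_incl {a : K} {c : Xᵒᵖ} (d : P.Elements) (z : (w.obj a).obj (op (op d)))
    (f : c.unop ⟶ d.1.unop) :
    (tmk z f : TensorObj w (elStar P) a c) = ((tensor w (elStar P)).obj a).map f.op (incl w a d z) :=
  congrArg (fun h => (tmk z h : TensorObj w (elStar P) a c)) (Category.comp_id f).symm

theorem incl_map {a : K} {d d' : P.Elements} (g : d ⟶ d') (z : (w.obj a).obj (op (op d))) :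
    incl w a d' ((w.obj a).map g.op.op z) =
      ((tensor w (elStar P)).obj a).map g.1 (incl w a d z) :=
  (tmk_sound (n := elStar P) (c := d'.1) g.op z (𝟙 d'.1.unop)).trans
    (congrArg (fun h => (tmk z h : TensorObj w (elStar P) a d'.1))
      ((Category.id_comp g.1.unop).trans (Category.comp_id g.1.unop).symm))

/-- A morphism out of `d` is determined by its underlying morphism in `X`, but its target element
only up to propositional equality. Stating this in the sigma type avoids transport. -/
theorem sigma_map_eq (F : (P.Elementsᵒᵖ)ᵒᵖ ⥤ Type u) {d : P.Elements} (z : F.obj (op (op d)))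
    {x : Xᵒᵖ} {e e' : P.obj x} (g : d ⟶ ⟨x, e⟩) (g' : d ⟶ ⟨x, e'⟩) (h : g.1 = g'.1) :
    (⟨e, F.map g.op.op z⟩ : Σ e : P.obj x, F.obj (op (op ⟨x, e⟩))) = ⟨e', F.map g'.op.op z⟩ := by
  have he : e = e' := g.2.symm.trans ((congrArg (fun k => P.map k d.2) h).trans g'.2)
  subst he
  rw [show g = g' from Subtype.ext h]

/-- The restriction `(x, P(f)(e)) ⟶ (y, e)` of an element along `f : x ⟶ y`, as a morphism of
`P.Elements`. -/
def elHom (d : P.Elements) {c : Xᵒᵖ} (f : c.unop ⟶ d.1.unop) : d ⟶ ⟨c, P.map f.op d.2⟩ :=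
  ⟨f.op, rfl⟩

/-- The decomposition of the coend `∫^{(y, e)} w((y, e), a) × X(x, y)` as a sum indexed by the
elements of `P(x)`. -/
def toSigma (a : K) (x : Xᵒᵖ) :
    TensorObj w (elStar P) a x → Σ e : P.obj x, (w.obj a).obj (op (op ⟨x, e⟩)) :=
  tensorDesc (fun (d : P.Elementsᵒᵖ) z (f : x.unop ⟶ d.unop.1.unop) =>
      ⟨P.map f.op d.unop.2, (w.obj a).map (elHom d.unop f).op.op z⟩) (by
    intro d d' g z f
    have h : (w.obj a).map (elHom d.unop f).op.op ((w.obj a).map g.op z) =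
        (w.obj a).map (g.unop ≫ elHom d.unop f).op.op z :=
      (Functor.map_comp_apply (w.obj a) g.op (elHom d.unop f).op.op z).symm
    rw [h]
    exact sigma_map_eq (w.obj a) z _ _ rfl)

theorem toSigma_incl (a : K) {x : Xᵒᵖ} (e : P.obj x) (z : (w.obj a).obj (op (op ⟨x, e⟩))) :
    toSigma w a x (incl w a ⟨x, e⟩ z) = ⟨e, z⟩ := by
  refine (sigma_map_eq (w.obj a) z (elHom ⟨x, e⟩ (𝟙 x.unop)) (𝟙 _) rfl).trans ?_
  exact congrArg (Sigma.mk e) (Functor.map_id_apply (w.obj a) _ z)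

/-- The class of `(z, f)` is normalised by sliding the lift `elHom` of `f` across the coend.
Together with `toSigma_incl` this makes `toSigma` bijective. -/
theorem incl_toSigma (a : K) {x : Xᵒᵖ} (t : TensorObj w (elStar P) a x) :
    incl w a ⟨x, (toSigma w a x t).1⟩ (toSigma w a x t).2 = t := by
  induction t using tensor_ind with | h d z f => ?_
  exact (incl_map w (elHom d.unop f) z).trans (tmk_eq_map_incl w d.unop z f).symm

theorem incl_injective (a : K) (d : P.Elements) : Function.Injective (incl w a d) := by
  intro z z' h
  obtain ⟨x, e⟩ := d
  have := congrArg (toSigma w a x) h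
  rw [toSigma_incl, toSigma_incl] at this
  exact eq_of_heq (Sigma.mk.inj this).2

/-- Together with `incl_injective`, this recovers `w` from `w ; p_*` as its fibers over `P`. -/
theorem exists_incl (a : K) (d : P.Elements) (t : TensorObj w (elStar P) a d.1)
    (h : (toSigma w a d.1 t).1 = d.2) : ∃ z, incl w a d z = t := by
  obtain ⟨x, e⟩ := d
  change TensorObj w (elStar P) a x at t
  change (toSigma w a x t).1 = e at h
  subst h
  exact ⟨_, incl_toSigma w a t⟩

/-- A morphism `w ⟶ w'` is the same as a morphism `w ; p_* ⟶ w' ; p_*` over `P`. -/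
theorem exists_tensorMap_eq {w w' : Profunctor.{u} K P.Elementsᵒᵖ}
    (φ : tensor w (elStar P) ⟶ tensor w' (elStar P))
    (hφ : ∀ (a : K) (x : Xᵒᵖ) (t : TensorObj w (elStar P) a x),
      (toSigma w' a x ((φ.app a).app x t)).1 = (toSigma w a x t).1) :
    ∃ α : w ⟶ w', tensorMap α (𝟙 (elStar P)) = φ := by
  have hex (a : K) (d : P.Elements) (z : (w.obj a).obj (op (op d))) :
      ∃ z', incl w' a d z' = (φ.app a).app d.1 (incl w a d z) :=
    exists_incl w' a d _ ((hφ _ _ _).trans (congrArg Sigma.fst (toSigma_incl w a d.2 z)))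
  -- Since `φ` preserves the index in `P`, it restricts to fibers. Injectivity of `incl` makes the
  -- restrictions natural.
  choose α hα using hex
  refine ⟨
    { app := fun a =>
        { app := fun d => ↾(α a d.unop.unop)
          naturality := fun d d' g => by
            ext z
            refine incl_injective w' a d'.unop.unop ((hα a d'.unop.unop _).trans ?_)
            refine Eq.trans ?_ (incl_map w' g.unop.unop (α a d.unop.unop z)).symm
            rw [hα]
            refine (congrArg _ (incl_map w g.unop.unop z)).trans ?_
            exact NatTrans.naturality_apply (φ.app a) g.unop.unop.1 (incl w a _ z) }
      naturality := fun a a' g => by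
        ext d z
        refine incl_injective w' a' d.unop.unop ((hα a' d.unop.unop _).trans ?_)
        refine Eq.trans ?_ (congrArg (((tensor w' (elStar P)).map g).app _) (hα a d.unop.unop z)).symm
        exact congrArg (fun β : (tensor w (elStar P)).obj a ⟶ (tensor w' (elStar P)).obj a' =>
          β.app d.unop.unop.1 (incl w a _ z)) (φ.naturality g) },
    tensor_hom_ext fun a c d z f => ?_⟩
  refine (tmk_eq_map_incl w' d.unop _ f).trans ?_
  rw [tmk_eq_map_incl w d.unop z f]
  refine Eq.trans ?_ (NatTrans.naturality_apply (φ.app a) f.op (incl w a d.unop z)).symm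
  exact congrArg _ (hα a d.unop z)

end Elements

/-! ### Recovering a module over a presheaf from its fibers. -/

section Reflect

variable {K X : Type u} [SmallCategory K] [SmallCategory X] {P : Xᵒᵖ ⥤ Type u}
  (q : Profunctor.{u} K X) (θ : q ⟶ (Functor.const K).obj P)

/-- The module whose value at `((x, e), a)` is the fiber over `e` of `q(x, a) ⟶ P(x)`. -/
def fiberModule : Profunctor.{u} K P.Elementsᵒᵖ where
  obj a :=
    { obj := fun d => { t : (q.obj a).obj d.unop.unop.1 // (θ.app a).app _ t = d.unop.unop.2 }
      map := fun {d d'} g => ↾(fun t => ⟨(q.obj a).map g.unop.unop.1 t.1, by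
        refine (NatTrans.naturality_apply (θ.app a) g.unop.unop.1 t.1).trans ?_
        exact (congrArg _ t.2).trans g.unop.unop.2⟩)
      map_id := fun d => by
        ext t; exact (Functor.map_id_apply (q.obj a) _ t.1)
      map_comp := fun g h => by
        ext t; exact (Functor.map_comp_apply (q.obj a) _ _ t.1) }
  map {a a'} g :=
    { app := fun d => ↾(fun t => ⟨(q.map g).app _ t.1, by
        refine Eq.trans ?_ t.2
        exact congrArg (fun β : q.obj a ⟶ P => β.app _ t.1) (θ.naturality g)⟩)
      naturality := fun d d' h => by
        ext t; exact (NatTrans.naturality_apply (q.map g) h.unop.unop.1 t.1) }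
  map_id a := by
    ext d t
    exact congrArg (fun β : q.obj a ⟶ q.obj a => β.app d.unop.unop.1 t.1) (q.map_id a)
  map_comp g h := by
    ext d t
    exact map_comp_app q g h d.unop.unop.1 t.1

/-- The canonical morphism from the composite of the module of fibers with `p_*`. -/
def fiberModuleHom : tensor (fiberModule q θ) (elStar P) ⟶ q where
  app a :=
    { app := fun c => ↾(tensorDesc
        (fun (d : P.Elementsᵒᵖ) (t : ((fiberModule q θ).obj a).obj (op d))
          (f : c.unop ⟶ d.unop.1.unop) => (q.obj a).map f.op t.1)
        (fun g t f => (obj_map_comp (q.obj a) f g.unop.1.unop t.1).symm))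
      naturality := fun c c' g => by
        ext t; induction t using tensor_ind with | h d t f => ?_
        exact obj_map_comp (q.obj a) g.unop f t.1 }
  naturality a a' g := by
    ext c t; induction t using tensor_ind with | h d t f => ?_
    exact (NatTrans.naturality_apply (q.map g) (Quiver.Hom.op f) t.1).symm

theorem fiberModuleHom_incl (a : K) (d : P.Elements)
    (t : ((fiberModule q θ).obj a).obj (op (op d))) :
    ((fiberModuleHom q θ).app a).app d.1 (incl _ a d t) = t.1 :=
  Functor.map_id_apply (q.obj a) _ t.1

/-- Pointwise, the inverse places `s` in the fiber over its own image `θ(s)`: a set over `P(c)` is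
the sum of its fibers. -/
theorem isIso_fiberModuleHom : IsIso (fiberModuleHom q θ) := by
  rw [NatTrans.isIso_iff_isIso_app]
  intro a
  rw [NatTrans.isIso_iff_isIso_app]
  intro c
  rw [isIso_iff_bijective]
  -- The element of `P` at which `incl` is taken depends on `s`, so the equality is substituted
  -- rather than rewritten.
  have hcongr {s s' : (q.obj a).obj c} (h : s = s') :
      (incl (fiberModule q θ) a ⟨c, (θ.app a).app c s⟩ ⟨s, rfl⟩ :
        TensorObj (fiberModule q θ) (elStar P) a c) =
      incl (fiberModule q θ) a ⟨c, (θ.app a).app c s'⟩ ⟨s', rfl⟩ := by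
    subst h; rfl
  have key (t : TensorObj (fiberModule q θ) (elStar P) a c) :
      incl (fiberModule q θ) a ⟨c, (θ.app a).app c (((fiberModuleHom q θ).app a).app c t)⟩
        ⟨((fiberModuleHom q θ).app a).app c t, rfl⟩ = t := by
    obtain ⟨⟨e, s, hs⟩, rfl⟩ : ∃ s : Σ e : P.obj c, ((fiberModule q θ).obj a).obj (op (op ⟨c, e⟩)),
      incl (fiberModule q θ) a ⟨c, s.1⟩ s.2 = t := ⟨_, incl_toSigma _ a t⟩
    change (q.obj a).obj c at s
    change (θ.app a).app c s = e at hs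
    subst hs
    exact hcongr (fiberModuleHom_incl q θ a ⟨c, (θ.app a).app c s⟩ ⟨s, rfl⟩)
  refine ⟨fun t t' h => ?_, fun s => ⟨incl _ a ⟨c, (θ.app a).app c s⟩ ⟨s, rfl⟩, ?_⟩⟩
  · rw [← key t, ← key t', h]
  · exact fiberModuleHom_incl q θ a _ _

end Reflect

/-! ### The comparison functor is an equivalence. -/

section Tabulation

variable {K X : SetMod.{u}} {m : one ⟶ X}

/-- The 2-cell `k ; m ⟶ m` that forgets the first component. -/
def bangEval (m : one ⟶ X) (k : K ⟶ one) :
    (k ≫ m : K ⟶ X) ⟶ (Functor.const K.carrier).obj (presheaf m) where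
  app (a : K.carrier) :=
    { app := fun x => ↾(tensorDesc (m := k) (n := m) (a := a) (c := x)
        (fun (b : Discrete PUnit.{u + 1}) _ (z : (presheaf m).obj x) => z) (by
          rintro ⟨⟨⟩⟩ ⟨⟨⟩⟩ (f : (⟨PUnit.unit⟩ : Discrete PUnit.{u + 1}) ⟶ ⟨PUnit.unit⟩) y z
          rw [Subsingleton.elim f (𝟙 (⟨PUnit.unit⟩ : Discrete PUnit.{u + 1}))]
          exact congrArg (fun β : presheaf m ⟶ presheaf m => β.app x z)
            (CategoryTheory.Functor.map_id m (⟨PUnit.unit⟩ : Discrete PUnit.{u + 1})).symm))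
      naturality := fun x x' g => by
        ext t; induction t using tensor_ind with | h b y z => rfl }
  naturality (a a' : K.carrier) g := by
    ext x t; induction t using tensor_ind with | h b y z => rfl

/-- The forgotten component lies in a singleton. Hence 2-cells into `k ≫ m` may be compared after
mapping to `P`. -/
theorem bangEval_injective (k : K ⟶ one) (hk : IsLeftAdjoint k) (a : K.carrier)
    (x : X.carrierᵒᵖ) :
    Function.Injective ((NatTrans.app (bangEval m k) a).app x) := by
  intro t t' h
  induction t using tensor_ind with | h b y z => ?_
  induction t' using tensor_ind with | h b' y' z' => ?_
  obtain ⟨⟨⟩⟩ := b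
  obtain ⟨⟨⟩⟩ := b'
  obtain ⟨i⟩ := unique_fiber_of_isLeftAdjoint k hk a
  obtain rfl : y = y' := (i.uniq y).trans (i.uniq y').symm
  exact congrArg (tmk y) h

/-- Both sides send `(z, f)` at `(y, e)` to `P(f)(e)`. This turns the abstract comma condition into
preservation of the index in `P`. -/
theorem bangEval_tabulationCell {k : K ⟶ one} (hk : Limits.IsTerminal k) (w : K ⟶ El m)
    (a : K.carrier) (x : X.carrierᵒᵖ) (t : TensorObj w (elStar (presheaf m)) a x) :
    (NatTrans.app (bangEval m k) a).app x
      ((NatTrans.app ((tabulationCell (elCell m) hk).app w) a).app x t) =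
        (toSigma w a x t).1 := by
  induction t using tensor_ind with | h d z f => rfl

instance (k : K ⟶ one) (hk : Limits.IsTerminal k) :
    (commaComparison _ _ (tabulationCell (elCell m) hk)).Faithful where
  map_injective {w w'} α β h := by
    have h' : α ▷ lowerStar (elProj m) = β ▷ lowerStar (elProj m) :=
      congrArg CommaMorphism.left h
    refine hom_app_ext fun a d z => incl_injective w' a d.unop.unop ?_
    exact congrArg (fun γ : w ≫ lowerStar (elProj m) ⟶ w' ≫ lowerStar (elProj m) =>
      (NatTrans.app γ a).app d.unop.unop.1 (incl w a d.unop.unop z)) h'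

instance (k : K ⟶ one) (hk : Limits.IsTerminal k) :
    (commaComparison _ _ (tabulationCell (elCell m) hk)).Full where
  map_surjective {w w'} φ := by
    obtain ⟨α, hα⟩ := exists_tensorMap_eq (w := w) (w' := w') φ.left fun a x t => by
      -- The right-hand component of `φ` lives in the point category, so its image is the identity
      -- of `k ≫ m`.
      have h : φ.left ≫ (tabulationCell (elCell m) hk).app w' =
          (tabulationCell (elCell m) hk).app w ≫ 𝟙 (k ≫ m) := φ.w
      refine (bangEval_tabulationCell hk w' a x _).symm.trans
        (Eq.trans ?_ (bangEval_tabulationCell hk w a x t))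
      exact congrArg (fun γ : w ≫ lowerStar (elProj m) ⟶ k ≫ m =>
        (NatTrans.app (bangEval m k) a).app x ((NatTrans.app γ a).app x t)) h
    exact ⟨α, CommaMorphism.ext hα (Subsingleton.elim _ _)⟩

theorem essSurj_commaComparison (k : K ⟶ one) (hl : IsLeftAdjoint k) (hk : Limits.IsTerminal k) :
    (commaComparison _ _ (tabulationCell (elCell m) hk)).EssSurj where
  mem_essImage Y := by
    let q : K ⟶ X := Y.left
    let θ : q ⟶ k ≫ m := Y.hom
    -- The preimage is the module of fibers of the structure map, viewed as a map to `P`.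
    let w : K ⟶ El m := fiberModule q (θ ≫ bangEval m k)
    let L : w ≫ lowerStar (elProj m) ⟶ q := fiberModuleHom q (θ ≫ bangEval m k)
    have hL : IsIso L := isIso_fiberModuleHom q (θ ≫ bangEval m k)
    let i : w ≫ lowerStar (elProj m) ≅ q := asIso L
    have h : L ≫ θ = (tabulationCell (elCell m) hk).app w := by
      refine hom_app_ext fun a x t => bangEval_injective k hl a x ?_
      refine Eq.trans ?_ (bangEval_tabulationCell hk w a x t).symm
      induction t using tensor_ind with | h d z f => ?_
      refine (NatTrans.naturality_apply (NatTrans.app (θ ≫ bangEval m k) a)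
        (Quiver.Hom.op f) z.1).trans ?_
      -- `z.2` is the fiber condition: `z` lies over the element `d`.
      exact congrArg _ z.2
    exact ⟨w, ⟨Comma.isoMk i (Iso.refl _) (h.trans (Category.comp_id _).symm)⟩⟩

theorem isTabulation_elCell (m : one ⟶ X) :
    IsTabulation m (bang (El m)) (lowerStar (elProj m)) (elCell m) where
  bang_isLeftAdjoint := lowerStar_isLeftAdjoint _
  isLeftAdjoint := lowerStar_isLeftAdjoint _
  comma _ k hl hk :=
    -- Fullness and faithfulness come from the instances above, so this completes the equivalence.
    have := essSurj_commaComparison (m := m) k hl hk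
    { }

end Tabulation

end SetMod

theorem mainTheorem8 :
    HasTabulationsFromTerminal SetMod.{u} ∧
    IsLeftAdjointTerminal SetMod.one.{u} ∧
    ∀ (X : SetMod.{u}) (m : SetMod.one ⟶ X),
      IsTabulation m (SetMod.bang (SetMod.El m)) (SetMod.lowerStar (SetMod.elProj m))
        (SetMod.elCell m) :=
  ⟨⟨SetMod.one, SetMod.isLeftAdjointTerminal_one, fun _ m =>
    ⟨_, _, _, _, SetMod.isTabulation_elCell m⟩⟩, SetMod.isLeftAdjointTerminal_one,
    fun _ m => SetMod.isTabulation_elCell m⟩
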